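/- For $A\in\mathbb R^{m\times T}$ with singular values $\sigma_1(A)\ge\sigma_2(A)\ge\dots\ge 0$ and $0<p<\infty$ put $\|A\|_{S_p}=\big(\sum_{j=1}^{\min(m,T)}\sigma_j(A)^p\big)^{1/p}$ (so $\|\cdot\|_{S_2}$ is the Frobenius norm), and let $\operatorname{tr}(X'A)$ denote the trace of $X'A$, where $X'$ is the transpose of $X$. There is a function $\beta=\beta(M,\alpha)$, positive for all integers $M\ge 8$ and all $0<\alpha<1/8$, with $\beta(M,\alpha)\to1$ as $M\to\infty$, $\alpha\to0$, such that the following holds. Let $N\ge1$, let $\xi_1,\dots,\xi_N$ be i.i.d. $\mathcal N(0,\sigma^2)$ random variables with $\sigma>0$, let $M=\max(m,T)\ge 8$ and $1\le r\le\min(m,T)$, and let $X_1,\dots,X_N$ be random matrices in $\mathbb R^{m\times T}$ such that $(X_1,\dots,X_N)$ is independent of $(\xi_1,\dots,\xi_N)$. For $A\in\mathbb R^{m\times T}$ let $\mathcal L(A)=N^{-1/2}(\operatorname{tr}(X_1'A),\dots,\operatorname{tr}(X_N'A))\in\mathbb R^N$, and assume that for some $\nu>0$ $$\nu^2\,\mathbb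 E|\mathcal L(A)|_2^2\le\|A\|_{S_2}^2\qquad\text{for all }A\in\mathbb R^{m\times T}\text{ with }\operatorname{rank}(A)\le r.$$ Let $\mathbb P_{A}$ be the distribution of $(X_1,Y_1),\dots,(X_N,Y_N)$, where $Y_i=\operatorname{tr}(X_i'A)+\xi_i$. Then for all $p\in(0,2]$, $\Delta>0$ and $0<\alpha<1/8$, $$\inf_{\hat A}\ \sup_{\substack{A^*\in\mathbb R^{m\times T}:\ \operatorname{rank}(A^*)\le r,\\ \|A^*\|_{S_p}\le\Delta\nu\sigma}}\mathbb P_{A^*}\Big(\tfrac1{\nu^2}\|\hat A-A^*\|_{S_2}^2>C'(\alpha)\,\sigma^2\,\psi_{M,N,r,\Delta}\Big)\ \ge\ \beta(M,\alpha),$$ where the infimum is over all estimators $\hat A$, that is, all measurable functions of $(X_1,Y_1),\dots,(X_N,Y_N)$ with values in $\mathbb R^{m\times T}$, and $$C'(\alpha)=\frac{\alpha(\log 2)2^{-2/p}}{128},\qquad \psi_{M,N,r,\Delta}=\min\Big(\frac{rM}{N},\ \Delta^p\Big(\frac MN\Big)^{1-p/2},\ \Delta^2\Big).$$ In particular, suppose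 (uniform sampling at random) that $X_1,\dots,X_N$ are independent and uniformly distributed on the set of the $mT$ matrices that have one entry equal to $1$ and all others equal to $0$, and are independent of $\xi_1,\dots,\xi_N$. Then $mT\,\mathbb E|\mathcal L(A)|_2^2=\|A\|_{S_2}^2$ for every $A\in\mathbb R^{m\times T}$, and the lower bound holds with $\nu=\sqrt{mT}$ and the same function $\beta$. -/

import Mathlib

open MeasureTheory ProbabilityTheory Filter Topology
open scoped ENNReal

noncomputable section

namespace TraceRegression

/-- The space of real `m × T` matrices. -/
abbrev Mat (m T : ℕ) : Type := Matrix (Fin m) (Fin T) ℝ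

/-- The `σ`-algebra on matrices generated by the entries. -/
instance instMeasurableSpaceMat (m T : ℕ) : MeasurableSpace (Mat m T) :=
  inferInstanceAs (MeasurableSpace (Fin m → Fin T → ℝ))

/-- The `j`-th (zero-indexed) largest singular value of `A`. -/
def singularValue {m T : ℕ} (A : Mat m T) (j : ℕ) : ℝ :=
  LinearMap.singularValues (Matrix.toEuclideanLin A) j

/-- The Schatten (quasi-)norm `‖A‖_{S_p} = (∑_{j ≤ min(m,T)} σ_j(A)^p)^{1/p}`, `0 < p < ∞`. -/
def schattenNorm {m T : ℕ} (p : ℝ) (A : Mat m T) : ℝ :=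
  (∑ j ∈ Finset.range (min m T), singularValue A j ^ p) ^ (1 / p)

/-- The sampling operator
`A ↦ (tr(X₁'A), …, tr(X_N'A)) / √N` with masks `X₁, …, X_N`. -/
def samplingOperator {N m T : ℕ} (X : Fin N → Mat m T) (A : Mat m T) :
    EuclideanSpace ℝ (Fin N) :=
  WithLp.toLp 2 fun i => Matrix.trace ((X i).transpose * A) / √(N : ℝ)

/-- A sample `((X₁, …, X_N), (Y₁, …, Y_N))`. -/
abbrev Sample (N m T : ℕ) : Type := (Fin N → Mat m T) × (Fin N → ℝ)

/-- The sample of the trace regression model `Y_i = tr(X_i'A) + ξ_i`. -/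
def sample {Ω : Type*} {N m T : ℕ} (X : Fin N → Ω → Mat m T) (ξ : Fin N → Ω → ℝ)
    (A : Mat m T) (ω : Ω) : Sample N m T :=
  (fun i => X i ω, fun i => Matrix.trace ((X i ω).transpose * A) + ξ i ω)

/-- The distribution of the sample when the unknown matrix is `A`. -/
def sampleLaw {Ω : Type*} [MeasurableSpace Ω] (P : Measure Ω) {N m T : ℕ}
    (X : Fin N → Ω → Mat m T) (ξ : Fin N → Ω → ℝ) (A : Mat m T) : Measure (Sample N m T) :=
  P.map (sample X ξ A)

/-- `ξ₁, …, ξ_N` are i.i.d. `N(0, σ²)`, and the random masks `X₁, …, X_N` (with an arbitrary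
joint distribution) are independent of them. -/
structure IsGaussianDesign {Ω : Type*} [MeasurableSpace Ω] (P : Measure Ω) {N m T : ℕ}
    (X : Fin N → Ω → Mat m T) (ξ : Fin N → Ω → ℝ) (σ : ℝ) : Prop where
  measurable_mask : ∀ i, Measurable (X i)
  measurable_noise : ∀ i, Measurable (ξ i)
  noise_law : ∀ i, HasLaw (ξ i) (gaussianReal 0 (Real.toNNReal (σ ^ 2))) P
  noise_indep : iIndepFun ξ P
  mask_indep_noise : IndepFun (fun ω i => X i ω) (fun ω i => ξ i ω) P

/-- `ν² E|L(A)|₂² ≤ ‖A‖_{S_2}²` for all `A` of rank at most `r`. -/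
def SamplingBound {Ω : Type*} [MeasurableSpace Ω] (P : Measure Ω) {N m T : ℕ}
    (X : Fin N → Ω → Mat m T) (r : ℕ) (ν : ℝ) : Prop :=
  ∀ A : Mat m T, A.rank ≤ r →
    Integrable (fun ω => ‖samplingOperator (fun i => X i ω) A‖ ^ 2) P ∧
      ν ^ 2 * ∫ ω, ‖samplingOperator (fun i => X i ω) A‖ ^ 2 ∂P ≤ schattenNorm 2 A ^ 2

/-- The point masks `e_k(m) e_l(T)'`. -/
def pointMasks (m T : ℕ) : Set (Mat m T) :=
  {B | ∃ (k : Fin m) (l : Fin T), B = Matrix.single k l 1}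

/-- Uniform sampling at random: the masks are independent and uniformly distributed on the
set of point masks. -/
structure IsUSR {Ω : Type*} [MeasurableSpace Ω] (P : Measure Ω) {N m T : ℕ}
    (X : Fin N → Ω → Mat m T) : Prop where
  law : ∀ i, HasLaw (X i) (uniformOn (pointMasks m T)) P
  indep : iIndepFun X P

/-- The rate `min(rM/N, Δ^p (M/N)^{1-p/2}, Δ²)`. -/
def rate (p : ℝ) (M N r : ℕ) (Δ : ℝ) : ℝ :=
  min ((r : ℝ) * M / N) (min (Δ ^ p * ((M : ℝ) / N) ^ (1 - p / 2)) (Δ ^ 2))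

/-- The constant `C'(α) = α (log 2) 2^{-2/p} / 128`. -/
def lowerConst (p α : ℝ) : ℝ :=
  α * Real.log 2 * (2 : ℝ) ^ (-2 / p) / 128

/-- The matrices of rank at most `r` with `‖A‖_{S_p} ≤ R`. -/
def parameterSet (m T r : ℕ) (p R : ℝ) : Set (Mat m T) :=
  {A | A.rank ≤ r ∧ schattenNorm p A ≤ R}

/-- The minimax probability
`inf_Â sup_{A ∈ Θ} P_A (ν⁻² ‖Â - A‖_{S_2}² > t)`, where the infimum is over all estimators,
i.e. all measurable functions of the sample. -/
def minimaxProb {Ω : Type*} [MeasurableSpace Ω] (P : Measure Ω) {N m T : ℕ}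
    (X : Fin N → Ω → Mat m T) (ξ : Fin N → Ω → ℝ) (Θ : Set (Mat m T)) (ν t : ℝ) : ℝ≥0∞ :=
  ⨅ (Ahat : Sample N m T → Mat m T) (_ : Measurable Ahat),
    ⨆ A ∈ Θ, sampleLaw P X ξ A {d | t < 1 / ν ^ 2 * schattenNorm 2 (Ahat d - A) ^ 2}

end TraceRegression

end

/-! An estimator with small error would distinguish many matrices that are far apart in Frobenius
norm but whose samples have nearly the same law; the bound quantifies that this is impossible.

The hypotheses are matrices with entries in {0, h} supported in `s` full lines of length `M =
max(m,T)`, so that their rank is at most `s ≤ r` (`exists_block`). Varshamov–Gilbert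
(`Finset.exists_varshamov_gilbert`) gives the zero matrix and at least `2^(sM/8)` others, any two of
them differing in at least `sM/8` entries. `exists_rank_level` balances `s` and `h`: the Kullback
divergence to `P_0` is at most α times the logarithm of `2^(sM/8)`, the Schatten ball contains all
hypotheses, and their separation exceeds twice the target error.

Given the masks, the sample is a shifted Gaussian vector, so likelihood ratios are explicit and a
second moment computation controls their tails
(`IsGaussianDesign.sampleLaw_lt_logLikelihoodRatio_le`). The balls around the hypotheses are
disjoint acceptance regions, and changing measure to `P_0` on each of them bounds the worst error
probability from below (`card_mul_exp_neg_mul_le_of_disjoint_tests`). For uniform sampling the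
design condition is an equality with `ν² = mT`. -/

/-! ### Separated families of finite sets -/

/-- A Chernoff-type bound for the volume of a Hamming ball of radius `D` in the cube of subsets
of `S`. -/
theorem Finset.card_powerset_filter_symmDiff_le {ι : Type*} [DecidableEq ι] (S : Finset ι)
    {C : Finset ι} (hC : C ⊆ S) (D : ℕ) :
    (((S.powerset.filter fun B => (symmDiff B C).card ≤ D).card : ℕ) : ℝ) ≤
      2 ^ D * (3 / 2) ^ S.card := by
  -- `B ↦ symmDiff B C` permutes the subsets of `S` because `C ⊆ S`, so the total weight is the
  -- binomial sum `(1 + 1/2)^|S|`. Each set of the ball weighs at least `2^(-D)`.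
  have hsum : ∑ B ∈ S.powerset, (1 / 2 : ℝ) ^ (symmDiff B C).card = (3 / 2) ^ S.card := by
    have h := Finset.sum_pow_mul_eq_add_pow (1 / 2 : ℝ) 1 S
    norm_num at h
    rw [← h]
    refine Finset.sum_nbij' (fun B => symmDiff B C) (fun B => symmDiff B C) ?_ ?_ ?_ ?_ ?_
    · intro B hB
      rw [Finset.mem_powerset] at hB ⊢
      exact (symmDiff_le_sup (a := B) (b := C)).trans (Finset.union_subset hB hC)
    · intro B hB
      rw [Finset.mem_powerset] at hB ⊢
      exact (symmDiff_le_sup (a := B) (b := C)).trans (Finset.union_subset hB hC)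
    · intro B _; simp
    · intro B _; simp
    · intro B _; norm_num
  have hle : ∑ B ∈ S.powerset.filter (fun B => (symmDiff B C).card ≤ D), (1 / 2 : ℝ) ^ D ≤
      (3 / 2) ^ S.card := by
    rw [← hsum]
    refine (Finset.sum_le_sum fun B hB => ?_).trans
      (Finset.sum_le_sum_of_subset_of_nonneg (Finset.filter_subset _ _) fun _ _ _ => by positivity)
    exact pow_le_pow_of_le_one (by norm_num) (by norm_num) (Finset.mem_filter.1 hB).2
  rw [Finset.sum_const, nsmul_eq_mul] at hle
  calc _ = 2 ^ D * ((((S.powerset.filter fun B => (symmDiff B C).card ≤ D).card : ℕ) : ℝ)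
        * (1 / 2) ^ D) := by
        rw [mul_comm, mul_assoc, ← mul_pow]; norm_num
    _ ≤ _ := by gcongr

/-- A maximal separated family of sets covers the cube by Hamming balls. -/
theorem Finset.exists_maximal_separated {ι : Type*} [DecidableEq ι] (S : Finset ι) (D : ℕ) :
    ∃ F : Finset (Finset ι), ∅ ∈ F ∧ (∀ B ∈ F, B ⊆ S) ∧
      (∀ B ∈ F, ∀ C ∈ F, B ≠ C → D < (symmDiff B C).card) ∧
      ∀ B ⊆ S, ∃ C ∈ F, (symmDiff B C).card ≤ D := by
  -- `∅` is forced into every competing family, since it will index the null hypothesis `A = 0`.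
  let Q : Finset (Finset (Finset ι)) := S.powerset.powerset.filter fun F => ∅ ∈ F ∧
    ∀ B ∈ F, ∀ C ∈ F, B ≠ C → D < (symmDiff B C).card
  have hQ : Q.Nonempty := ⟨{∅}, by simp [Q]⟩
  obtain ⟨F, hF, hmax⟩ := Q.exists_max_image Finset.card hQ
  simp only [Q, Finset.mem_filter, Finset.mem_powerset] at hF
  obtain ⟨hFS, hF0, hFd⟩ := hF
  refine ⟨F, hF0, fun B hB => Finset.mem_powerset.1 (hFS hB), hFd, fun B hB => ?_⟩
  by_contra! hfar
  have hBF : B ∉ F := fun h => by simpa using hfar B h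
  have hmem : insert B F ∈ Q := by
    simp only [Q, Finset.mem_filter, Finset.mem_powerset]
    refine ⟨Finset.insert_subset (Finset.mem_powerset.2 hB) hFS, Finset.mem_insert_of_mem hF0, ?_⟩
    intro B₁ h₁ B₂ h₂ hne
    rw [Finset.mem_insert] at h₁ h₂
    rcases h₁ with rfl | h₁ <;> rcases h₂ with rfl | h₂
    · exact absurd rfl hne
    · exact hfar _ h₂
    · rw [symmDiff_comm]; exact hfar _ h₁
    · exact hFd _ h₁ _ h₂ hne
  have := hmax _ hmem
  rw [Finset.card_insert_of_notMem hBF] at this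
  omega

/-- The **Varshamov–Gilbert bound**. -/
theorem Finset.exists_varshamov_gilbert {ι : Type*} [DecidableEq ι] (S : Finset ι)
    (hS : 8 ≤ S.card) :
    ∃ F : Finset (Finset ι), ∅ ∈ F ∧ (∀ B ∈ F, B ⊆ S) ∧
      (∀ B ∈ F, ∀ C ∈ F, B ≠ C → (S.card : ℝ) / 8 ≤ (symmDiff B C).card) ∧
      (2 : ℝ) ^ ((S.card : ℝ) / 8) ≤ (F.erase ∅).card := by
  obtain ⟨F, hF0, hFS, hFd, hcov⟩ := S.exists_maximal_separated (S.card / 8)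
  refine ⟨F, hF0, hFS, fun B hB C hC hne => ?_, ?_⟩
  · have h := hFd B hB C hC hne
    have h' : S.card < 8 * (symmDiff B C).card := by omega
    have : (S.card : ℝ) < 8 * (symmDiff B C).card := by exact_mod_cast h'
    linarith
  set d := S.card with hd
  have hcard : (2 : ℝ) ^ d ≤ F.card * (2 ^ (d / 8) * (3 / 2) ^ d) := by
    have h1 : S.powerset ⊆
        F.biUnion fun C => S.powerset.filter fun B => (symmDiff B C).card ≤ d / 8 := by
      intro B hB
      obtain ⟨C, hC, h⟩ := hcov B (Finset.mem_powerset.1 hB)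
      exact Finset.mem_biUnion.2 ⟨C, hC, Finset.mem_filter.2 ⟨hB, h⟩⟩
    have h2 := (Finset.card_le_card h1).trans Finset.card_biUnion_le
    rw [Finset.card_powerset] at h2
    have h3 : (2 : ℝ) ^ d ≤ ∑ C ∈ F,
        ((S.powerset.filter fun B => (symmDiff B C).card ≤ d / 8).card : ℝ) := by
      exact_mod_cast h2
    refine h3.trans ?_
    rw [← nsmul_eq_mul]
    exact Finset.sum_le_card_nsmul _ _ _ fun C hC =>
      S.card_powerset_filter_symmDiff_le (hFS C hC) _
  -- In powers of `x` the covering bound reads `x^8 ≤ |F| * x * x^5`, as `(3/2)^8 ≤ 2^5`. Hence `|F|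
  -- ≥ x^2`, and `x ≥ 2` gives `x^2 - 1 ≥ x`, which pays for removing `∅`.
  set x : ℝ := 2 ^ ((d : ℝ) / 8) with hx
  have hx8 : x ^ 8 = 2 ^ d := by
    rw [hx, ← Real.rpow_natCast, ← Real.rpow_mul (by norm_num), ← Real.rpow_natCast]
    congr 1; push_cast; ring
  have hx0 : 0 < x := by positivity
  have hx2 : 2 ≤ x := by
    have h8 : (8 : ℝ) ≤ d := by exact_mod_cast hS
    calc (2 : ℝ) = 2 ^ (1 : ℝ) := by norm_num
      _ ≤ x := Real.rpow_le_rpow_of_exponent_le (by norm_num) (by linarith)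
  have hfloor : (2 : ℝ) ^ (d / 8) ≤ x := by
    rw [hx, ← Real.rpow_natCast]
    refine Real.rpow_le_rpow_of_exponent_le (by norm_num) ?_
    have := Nat.cast_div_le (α := ℝ) (m := d) (n := 8)
    exact_mod_cast this
  have hthree : (3 / 2 : ℝ) ^ d ≤ x ^ 5 := by
    refine le_of_pow_le_pow_left₀ (n := 8) (by norm_num) (by positivity) ?_
    calc ((3 / 2 : ℝ) ^ d) ^ 8 = ((3 / 2 : ℝ) ^ 8) ^ d := by rw [← pow_mul, ← pow_mul, mul_comm]
      _ ≤ ((2 : ℝ) ^ 5) ^ d := pow_le_pow_left₀ (by norm_num) (by norm_num) _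
      _ = (x ^ 5) ^ 8 := by rw [← pow_mul, mul_comm 5 d, pow_mul, ← hx8, ← pow_mul, ← pow_mul]
  have hmul : x ^ 2 * x ^ 6 ≤ F.card * x ^ 6 := by
    calc x ^ 2 * x ^ 6 = 2 ^ d := by rw [← hx8]; ring
      _ ≤ _ := hcard
      _ ≤ F.card * (x * x ^ 5) := by gcongr
      _ = F.card * x ^ 6 := by ring
  have hF : x ^ 2 ≤ F.card := le_of_mul_le_mul_right hmul (by positivity)
  have hK : ((F.erase ∅).card : ℝ) = F.card - 1 := by
    rw [Finset.card_erase_of_mem hF0, Nat.cast_sub (Finset.card_pos.2 ⟨_, hF0⟩)]; simp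
  rw [hK]
  nlinarith

namespace TraceRegression

/-! ### Schatten norms -/

theorem singularValue_nonneg {m T : ℕ} (A : Mat m T) (j : ℕ) : 0 ≤ singularValue A j :=
  LinearMap.singularValues_nonneg _ j

theorem singularValue_eq_zero {m T : ℕ} {A : Mat m T} {j : ℕ} (h : A.rank ≤ j) :
    singularValue A j = 0 := by
  refine (LinearMap.singularValues_eq_zero_iff_le_finrank_range _).2 ?_
  have hA : Matrix.toEuclideanLin A =
      Matrix.toLin (PiLp.basisFun 2 ℝ (Fin T)) (PiLp.basisFun 2 ℝ (Fin m)) A :=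
    congrArg (fun f => f A) (Matrix.toLpLin_eq_toLin 2 2)
  rwa [hA,
    ← Matrix.rank_eq_finrank_range_toLin A (PiLp.basisFun 2 ℝ (Fin m)) (PiLp.basisFun 2 ℝ (Fin T))]

/-- Used to change the number of summands freely between `min m T`, `T` and any rank bound. The
condition `0 < p` matters: with `0 ^ 0 = 1` the vanishing singular values would count. -/
theorem sum_singularValue_rpow_eq {m T s : ℕ} {A : Mat m T} (h : A.rank ≤ s) {p : ℝ}
    (hp : 0 < p) :
    ∑ j ∈ Finset.range s, singularValue A j ^ p =
      ∑ j ∈ Finset.range A.rank, singularValue A j ^ p := by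
  symm
  refine Finset.sum_subset (Finset.range_mono h) fun j _ hj => ?_
  rw [singularValue_eq_zero (by simpa using hj), Real.zero_rpow hp.ne']

theorem rank_le_min {m T : ℕ} (A : Mat m T) : A.rank ≤ min m T :=
  le_min (A.rank_le_height) (A.rank_le_width)

/-- The Schatten `2`-norm is the Frobenius norm. -/
theorem schattenNorm_two_sq {m T : ℕ} (A : Mat m T) :
    schattenNorm 2 A ^ 2 = ∑ k, ∑ l, A k l ^ 2 := by
  have h0 : 0 ≤ ∑ j ∈ Finset.range (min m T), singularValue A j ^ (2 : ℝ) :=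
    Finset.sum_nonneg fun j _ => Real.rpow_nonneg (singularValue_nonneg A j) _
  have h1 : schattenNorm 2 A ^ 2 = ∑ j ∈ Finset.range (min m T), singularValue A j ^ (2 : ℝ) := by
    rw [schattenNorm, ← Real.rpow_natCast, ← Real.rpow_mul h0]
    norm_num
  rw [h1, sum_singularValue_rpow_eq (rank_le_min A) two_pos,
    ← sum_singularValue_rpow_eq A.rank_le_width two_pos]
  have hT : Module.finrank ℝ (EuclideanSpace ℝ (Fin T)) = T := by simp
  -- The trace of `A'A` is the sum of the squared singular values on the spectral side, and of the
  -- squared entries in the standard basis.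
  have h2 := (Matrix.toEuclideanLin A).isSymmetric_adjoint_comp_self.trace_eq_sum_eigenvalues hT
  rw [LinearMap.trace_eq_sum_inner _ (EuclideanSpace.basisFun (Fin T) ℝ)] at h2
  calc ∑ j ∈ Finset.range T, singularValue A j ^ (2 : ℝ)
      = ∑ j : Fin T, singularValue A j ^ 2 := by
        rw [Finset.sum_range]; simp
    _ = ∑ l, ∑ k, A k l ^ 2 := by
        simp only [singularValue, LinearMap.sq_singularValues_fin _ hT]
        refine Eq.trans ?_ (h2.symm.trans ?_)
        · simp
        · refine Finset.sum_congr rfl fun l _ => ?_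
          rw [LinearMap.comp_apply, LinearMap.adjoint_inner_right, real_inner_self_eq_norm_sq,
            EuclideanSpace.real_norm_sq_eq]
          simp [Matrix.toLpLin_apply]
    _ = _ := Finset.sum_comm

/-- Comparison of Schatten norms for matrices of rank at most `s`. -/
theorem schattenNorm_le_of_rank_le {m T s : ℕ} {A : Mat m T} (h : A.rank ≤ s) {p R : ℝ}
    (hp : 0 < p) (hp2 : p ≤ 2) (hR : 0 ≤ R)
    (hA : (s : ℝ) ^ (2 / p) * ∑ k, ∑ l, A k l ^ 2 ≤ s * R ^ 2) :
    schattenNorm p A ≤ R := by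
  have hnn : ∀ q : ℝ, ∀ t : Finset ℕ, 0 ≤ ∑ j ∈ t, singularValue A j ^ q := fun q t =>
    Finset.sum_nonneg fun j _ => Real.rpow_nonneg (singularValue_nonneg A j) _
  rcases Nat.eq_zero_or_pos s with rfl | hs
  · have : A.rank = 0 := by omega
    rw [schattenNorm, sum_singularValue_rpow_eq (rank_le_min A) hp, this]
    simpa [Real.zero_rpow (inv_pos.2 hp).ne'] using hR
  have hs' : (0 : ℝ) < s := by exact_mod_cast hs
  have hF : ∑ j ∈ Finset.range s, singularValue A j ^ (2 : ℝ) = ∑ k, ∑ l, A k l ^ 2 := by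
    rw [← schattenNorm_two_sq, schattenNorm, ← Real.rpow_natCast, ← Real.rpow_mul (hnn _ _),
      sum_singularValue_rpow_eq (rank_le_min A) two_pos, sum_singularValue_rpow_eq h two_pos]
    norm_num
  have hq : 1 ≤ 2 / p := by rwa [le_div_iff₀ hp, one_mul]
  -- Power mean inequality: `(∑ σ_j^p)^(2/p) ≤ s^(2/p - 1) ∑ σ_j²`. The hypothesis `hA` is this
  -- bound multiplied by `s`.
  have hJ := Real.rpow_sum_le_const_mul_sum_rpow_of_nonneg (Finset.range s)
    (f := fun j => singularValue A j ^ p) hq fun j _ => Real.rpow_nonneg (singularValue_nonneg A j) _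
  have hpow : ∀ j, (singularValue A j ^ p) ^ (2 / p) = singularValue A j ^ (2 : ℝ) := fun j => by
    rw [← Real.rpow_mul (singularValue_nonneg A j), mul_div_cancel₀ _ hp.ne']
  simp only [hpow, hF, Finset.card_range] at hJ
  have hle : (∑ j ∈ Finset.range s, singularValue A j ^ p) ^ (2 / p) ≤ R ^ 2 := by
    refine hJ.trans ?_
    rw [Real.rpow_sub_one hs'.ne', div_mul_eq_mul_div, div_le_iff₀ hs']
    linarith
  rw [schattenNorm, sum_singularValue_rpow_eq (rank_le_min A) hp, ← sum_singularValue_rpow_eq h hp]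
  refine le_of_pow_le_pow_left₀ two_ne_zero hR ?_
  rw [← Real.rpow_natCast, ← Real.rpow_mul (hnn _ _)]
  have h2 : 1 / p * ((2 : ℕ) : ℝ) = 2 / p := by push_cast; ring
  rwa [h2]

/-! ### Matrices with entries in `{0, h}` -/

/-- The matrix with entries `h` on `B` and `0` elsewhere. -/
def levelMatrix {m T : ℕ} (h : ℝ) (B : Finset (Fin m × Fin T)) : Mat m T :=
  Matrix.of fun k l => if (k, l) ∈ B then h else 0

theorem levelMatrix_empty {m T : ℕ} (h : ℝ) : levelMatrix (m := m) (T := T) h ∅ = 0 := by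
  ext; simp [levelMatrix]

theorem sum_levelMatrix_sq {m T : ℕ} (h : ℝ) (B : Finset (Fin m × Fin T)) :
    ∑ k, ∑ l, levelMatrix h B k l ^ 2 = B.card * h ^ 2 := by
  rw [← Fintype.sum_prod_type' (f := fun k l => levelMatrix h B k l ^ 2)]
  simp [levelMatrix, ite_pow, Finset.sum_ite_mem]

theorem sum_levelMatrix_sub_sq {m T : ℕ} (h : ℝ) (B C : Finset (Fin m × Fin T)) :
    ∑ k, ∑ l, (levelMatrix h B k l - levelMatrix h C k l) ^ 2 = (symmDiff B C).card * h ^ 2 := by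
  rw [← sum_levelMatrix_sq]
  refine Finset.sum_congr rfl fun k _ => Finset.sum_congr rfl fun l _ => ?_
  simp only [levelMatrix, Matrix.of_apply, Finset.mem_symmDiff]
  by_cases hB : (k, l) ∈ B <;> by_cases hC : (k, l) ∈ C <;> simp [hB, hC]

/-- Left multiplication by the coordinate projection onto the first `s` rows fixes the matrix, and
that projection has rank at most `s`. -/
theorem rank_levelMatrix_le_of_fst_lt {m T s : ℕ} (h : ℝ) {B : Finset (Fin m × Fin T)}
    (hB : ∀ x ∈ B, x.1.val < s) : (levelMatrix h B).rank ≤ s := by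
  classical
  let w : Fin m → ℝ := fun k => if k.val < s then 1 else 0
  have : levelMatrix h B = Matrix.diagonal w * levelMatrix h B := by
    ext k l
    rw [Matrix.diagonal_mul]
    by_cases hk : k.val < s
    · simp [w, hk]
    · have : (k, l) ∉ B := fun hx => hk (hB _ hx)
      simp [levelMatrix, this]
  rw [this]
  refine (Matrix.rank_mul_le_left _ _).trans ?_
  rw [Matrix.rank_diagonal, Fintype.card_subtype]
  simp only [w, ne_eq, ite_eq_right_iff, one_ne_zero, imp_false, not_not]
  exact (Fin.card_filter_val_lt ..).trans_le (min_le_right _ _)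

theorem rank_levelMatrix_le_of_snd_lt {m T s : ℕ} (h : ℝ) {B : Finset (Fin m × Fin T)}
    (hB : ∀ x ∈ B, x.2.val < s) : (levelMatrix h B).rank ≤ s := by
  have h1 : (levelMatrix h B).transpose =
      levelMatrix h (B.map (Equiv.prodComm (Fin m) (Fin T)).toEmbedding) := by
    ext l k
    simp [levelMatrix]
  rw [← Matrix.rank_transpose, h1]
  refine rank_levelMatrix_le_of_fst_lt h ?_
  simp only [Finset.mem_map_equiv]
  intro x hx
  exact hB _ hx

/-- A block of `s * max m T` entries which carries only matrices of rank at most `s`. -/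
theorem exists_block {m T s : ℕ} (hs : s ≤ min T m) :
    ∃ S : Finset (Fin m × Fin T), S.card = s * max m T ∧
      ∀ (h : ℝ), ∀ B ⊆ S, (levelMatrix h B).rank ≤ s := by
  -- Take `s` full rows if the rows are the longer lines, and `s` full columns otherwise.
  rcases le_total m T with hmT | hmT
  · refine ⟨(Finset.univ.filter fun k : Fin m => k.val < s) ×ˢ Finset.univ, ?_, fun h B hB => ?_⟩
    · rw [Finset.card_product, Fin.card_filter_val_lt, max_eq_right hmT]
      simp [(le_min_iff.1 hs).2]
    · exact rank_levelMatrix_le_of_fst_lt h fun x hx => by simpa using hB hx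
  · refine ⟨Finset.univ ×ˢ (Finset.univ.filter fun k : Fin T => k.val < s), ?_, fun h B hB => ?_⟩
    · rw [Finset.card_product, Fin.card_filter_val_lt, max_eq_left hmT]
      simp [(le_min_iff.1 hs).1, mul_comm]
    · exact rank_levelMatrix_le_of_snd_lt h fun x hx => by simpa using hB hx

end TraceRegression

/-! ### Likelihood ratios of shifted Gaussian product measures -/

/-- A product of probability measures with densities has the product density. -/
theorem MeasureTheory.Measure.pi_withDensity {ι : Type*} [Fintype ι] {E : ι → Type*}
    [∀ i, MeasurableSpace (E i)] (μ : ∀ i, Measure (E i)) [∀ i, IsProbabilityMeasure (μ i)]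
    {f : ∀ i, E i → ℝ≥0∞} (hf : ∀ i, Measurable (f i))
    [∀ i, SigmaFinite ((μ i).withDensity (f i))] :
    Measure.pi (fun i => (μ i).withDensity (f i)) =
      (Measure.pi μ).withDensity fun y => ∏ i, f i (y i) := by
  refine Measure.pi_eq fun s hs => ?_
  have hbox : MeasurableSet (Set.univ.pi s) := MeasurableSet.univ_pi hs
  have hm : ∀ i, Measurable ((s i).indicator (f i)) := fun i => (hf i).indicator (hs i)
  rw [withDensity_apply _ hbox, ← lintegral_indicator hbox]
  have hind : (Set.univ.pi s).indicator (fun y => ∏ i, f i (y i)) =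
      fun y => ∏ i, (s i).indicator (f i) (y i) := by
    funext y
    by_cases hy : y ∈ Set.univ.pi s
    · rw [Set.indicator_of_mem hy]
      exact Finset.prod_congr rfl fun i _ => (Set.indicator_of_mem (hy i trivial) _).symm
    · rw [Set.indicator_of_notMem hy]
      simp only [Set.mem_pi, Set.mem_univ, true_imp_iff, not_forall] at hy
      obtain ⟨i, hi⟩ := hy
      exact (Finset.prod_eq_zero (Finset.mem_univ i) (Set.indicator_of_notMem hi _)).symm
  -- The coordinates are independent under the product measure, so the integral of the product
  -- splits.
  rw [hind, lintegral_prod_eq_prod_lintegral_of_indepFun Finset.univ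
    (fun i (y : ∀ i, E i) => (s i).indicator (f i) (y i))
    (iIndepFun_pi fun i => (hm i).aemeasurable) fun i => (hm i).comp (measurable_pi_apply i)]
  refine Finset.prod_congr rfl fun i _ => ?_
  rw [withDensity_apply _ (hs i), ← lintegral_indicator (hs i),
    ← (measurePreserving_eval μ i).lintegral_comp (hm i)]

/-- Expanding the square: `-(y - a)² / 2 = -y² / 2 + (a y - a² / 2)`. -/
theorem ProbabilityTheory.gaussianReal_eq_withDensity (a : ℝ) {v : NNReal} (hv : v ≠ 0) :
    gaussianReal a v = (gaussianReal 0 v).withDensity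
      fun y => ENNReal.ofReal (Real.exp ((a * y - a ^ 2 / 2) / v)) := by
  rw [gaussianReal_of_var_ne_zero _ hv, gaussianReal_of_var_ne_zero _ hv,
    ← withDensity_mul _ (measurable_gaussianPDF 0 v) (by fun_prop)]
  congr 1
  funext y
  have hv' : (v : ℝ) ≠ 0 := by exact_mod_cast hv
  simp only [Pi.mul_apply, gaussianPDF_def, gaussianPDFReal_def]
  rw [← ENNReal.ofReal_mul (by positivity), mul_assoc (√(2 * Real.pi * v))⁻¹, ← Real.exp_add]
  congr 3
  field_simp
  ring

/-- A Gaussian vector shifted by `a` has density `exp ((⟨a, y⟩ - |a|² / 2) / v)` with respect to the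
centered one. -/
theorem ProbabilityTheory.pi_gaussianReal_eq_withDensity {N : ℕ} (a : Fin N → ℝ) {v : NNReal}
    (hv : v ≠ 0) :
    Measure.pi (fun i => gaussianReal (a i) v) =
      (Measure.pi fun _ : Fin N => gaussianReal 0 v).withDensity
        fun y => ENNReal.ofReal (Real.exp (∑ i, (a i * y i - a i ^ 2 / 2) / v)) := by
  have h : (fun i => gaussianReal (a i) v) = fun i => (gaussianReal 0 v).withDensity
      fun y => ENNReal.ofReal (Real.exp ((a i * y - a i ^ 2 / 2) / v)) :=
    funext fun i => gaussianReal_eq_withDensity (a i) hv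
  have : ∀ i, SigmaFinite ((gaussianReal 0 v).withDensity
      fun y => ENNReal.ofReal (Real.exp ((a i * y - a i ^ 2 / 2) / v))) := fun i => by
    rw [← gaussianReal_eq_withDensity (a i) hv]; infer_instance
  rw [h, Measure.pi_withDensity _ fun i => by fun_prop]
  congr 1
  funext y
  rw [Real.exp_sum, ENNReal.ofReal_prod_of_nonneg fun i _ => (Real.exp_pos _).le]

/-- The left side is the mass of `S` under the shifted Gaussian, whose density with respect to the
centered one is at most `exp c` on `S`. -/
theorem ProbabilityTheory.pi_gaussianReal_preimage_add_le {N : ℕ} (a : Fin N → ℝ) {v : NNReal}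
    (hv : v ≠ 0) {S : Set (Fin N → ℝ)} (hS : MeasurableSet S) {c : ℝ}
    (hc : ∀ y ∈ S, ∑ i, (a i * y i - a i ^ 2 / 2) / v ≤ c) :
    (Measure.pi fun _ : Fin N => gaussianReal 0 v) ((fun z i => a i + z i) ⁻¹' S) ≤
      ENNReal.ofReal (Real.exp c) * (Measure.pi fun _ : Fin N => gaussianReal 0 v) S := by
  have hmap := Measure.pi_map_pi (μ := fun _ : Fin N => gaussianReal 0 v)
    (f := fun i z => a i + z) fun i => by fun_prop
  simp only [gaussianReal_map_const_add, zero_add] at hmap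
  rw [← Measure.map_apply (by fun_prop) hS, hmap, pi_gaussianReal_eq_withDensity a hv,
    withDensity_apply _ hS, ← setLIntegral_const]
  exact setLIntegral_mono measurable_const fun y hy =>
    ENNReal.ofReal_le_ofReal (Real.exp_le_exp.2 (hc y hy))

namespace TraceRegression

/-- The log-likelihood ratio of `P_A` with respect to `P_0`. -/
noncomputable def logLikelihoodRatio {N m T : ℕ} (A : Mat m T) (σ : ℝ) (d : Sample N m T) : ℝ :=
  ∑ i, (Matrix.trace ((d.1 i).transpose * A) * d.2 i -
    Matrix.trace ((d.1 i).transpose * A) ^ 2 / 2) / σ ^ 2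

theorem trace_transpose_mul_eq {m T : ℕ} (x A : Mat m T) :
    Matrix.trace (x.transpose * A) = ∑ l, ∑ k, x k l * A k l := by
  simp [Matrix.trace, Matrix.mul_apply]

@[fun_prop]
theorem measurable_trace_transpose_mul {β : Type*} [MeasurableSpace β] {m T : ℕ} (A : Mat m T)
    {f : β → Mat m T} (hf : Measurable f) :
    Measurable fun b => Matrix.trace ((f b).transpose * A) := by
  simp only [trace_transpose_mul_eq]
  fun_prop

theorem measurable_logLikelihoodRatio {N m T : ℕ} (A : Mat m T) (σ : ℝ) :
    Measurable (logLikelihoodRatio (N := N) A σ) := by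
  unfold logLikelihoodRatio
  fun_prop

theorem measurable_sample {Ω : Type*} [MeasurableSpace Ω] {N m T : ℕ}
    {X : Fin N → Ω → Mat m T} {ξ : Fin N → Ω → ℝ} (hX : ∀ i, Measurable (X i))
    (hξ : ∀ i, Measurable (ξ i)) (A : Mat m T) : Measurable (sample X ξ A) := by
  unfold sample
  fun_prop

/-- Independence of masks and noise lets one fix the masks, which leaves a deterministic shift of
Gaussian noise. The law of the masks is the same for all `A`, so likelihood comparisons reduce to
fixed masks. -/
theorem IsGaussianDesign.sampleLaw_apply {Ω : Type*} [MeasurableSpace Ω] {P : Measure Ω}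
    [IsProbabilityMeasure P] {N m T : ℕ} {X : Fin N → Ω → Mat m T} {ξ : Fin N → Ω → ℝ} {σ : ℝ}
    (hD : IsGaussianDesign P X ξ σ) (A : Mat m T) {S : Set (Sample N m T)}
    (hS : MeasurableSet S) :
    sampleLaw P X ξ A S = ∫⁻ x, (Measure.pi fun _ : Fin N => gaussianReal 0 (σ ^ 2).toNNReal)
      ((fun z i => Matrix.trace ((x i).transpose * A) + z i) ⁻¹' (Prod.mk x ⁻¹' S))
      ∂(P.map fun ω i => X i ω) := by
  have hX : Measurable fun ω i => X i ω := measurable_pi_lambda _ hD.measurable_mask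
  let g : (Fin N → Mat m T) × (Fin N → ℝ) → Sample N m T :=
    fun q => (q.1, fun i => Matrix.trace ((q.1 i).transpose * A) + q.2 i)
  have hg : Measurable g := by
    change Measurable fun q : (Fin N → Mat m T) × (Fin N → ℝ) =>
      (q.1, fun i => Matrix.trace ((q.1 i).transpose * A) + q.2 i)
    fun_prop
  have hlaw : HasLaw (fun ω => ((fun i => X i ω), fun i => ξ i ω))
      ((P.map fun ω i => X i ω).prod
        (Measure.pi fun _ : Fin N => gaussianReal 0 (σ ^ 2).toNNReal)) P :=
    (indepFun_iff_hasLaw_prodMk_prod ⟨hX.aemeasurable, rfl⟩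
      (iIndepFun.hasLaw_pi hD.noise_law hD.noise_indep)).1 hD.mask_indep_noise
  have hsample : sample X ξ A = g ∘ fun ω => ((fun i => X i ω), fun i => ξ i ω) := rfl
  have hpair : Measurable fun ω => ((fun i => X i ω), fun i => ξ i ω) :=
    hX.prodMk (measurable_pi_lambda _ hD.measurable_noise)
  rw [sampleLaw, hsample, ← Measure.map_map hg hpair, hlaw.map_eq, Measure.map_apply hg hS,
    Measure.prod_apply (hg hS)]
  rfl

/-- Change of measure from `P_A` to `P_0` where the log-likelihood ratio is at most `c`. -/
theorem IsGaussianDesign.sampleLaw_le_of_logLikelihoodRatio_le {Ω : Type*} [MeasurableSpace Ω]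
    {P : Measure Ω} [IsProbabilityMeasure P] {N m T : ℕ} {X : Fin N → Ω → Mat m T}
    {ξ : Fin N → Ω → ℝ} {σ : ℝ} (hσ : 0 < σ) (hD : IsGaussianDesign P X ξ σ) (A : Mat m T)
    {S : Set (Sample N m T)} (hS : MeasurableSet S) {c : ℝ}
    (hc : ∀ d ∈ S, logLikelihoodRatio A σ d ≤ c) :
    sampleLaw P X ξ A S ≤ ENNReal.ofReal (Real.exp c) * sampleLaw P X ξ 0 S := by
  have hv : ((σ ^ 2).toNNReal : ℝ) = σ ^ 2 := Real.coe_toNNReal _ (by positivity)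
  have hv0 : (σ ^ 2).toNNReal ≠ 0 := by
    rw [Ne, Real.toNNReal_eq_zero, not_le]; positivity
  rw [hD.sampleLaw_apply A hS, hD.sampleLaw_apply 0 hS,
    ← lintegral_const_mul' _ _ ENNReal.ofReal_ne_top]
  refine lintegral_mono fun x => ?_
  simp only [Matrix.mul_zero, Matrix.trace_zero, zero_add, Set.preimage_id']
  refine pi_gaussianReal_preimage_add_le _ hv0 (measurable_prodMk_left hS) fun y hy => ?_
  rw [hv]
  exact hc (x, y) hy

/-- A tail bound for the log-likelihood ratio in terms of the Kullback divergence. -/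
theorem IsGaussianDesign.sampleLaw_lt_logLikelihoodRatio_le {Ω : Type*} [MeasurableSpace Ω]
    {P : Measure Ω} [IsProbabilityMeasure P] {N m T : ℕ} {X : Fin N → Ω → Mat m T}
    {ξ : Fin N → Ω → ℝ} {σ : ℝ} (hσ : 0 < σ) (hD : IsGaussianDesign P X ξ σ) (A : Mat m T)
    (hint : Integrable (fun ω => ∑ i, Matrix.trace ((X i ω).transpose * A) ^ 2) P) {κ c : ℝ}
    (hκ : ∫ ω, ∑ i, Matrix.trace ((X i ω).transpose * A) ^ 2 ∂P ≤ 2 * σ ^ 2 * κ) (hc : 0 < c) :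
    (sampleLaw P X ξ A).real {d | c < logLikelihoodRatio A σ d} ≤ (κ + √(κ / 2)) / c := by
  set t : Fin N → Ω → ℝ := fun i ω => Matrix.trace ((X i ω).transpose * A) with ht_def
  have htm : ∀ i, Measurable (t i) := fun i =>
    measurable_trace_transpose_mul A (hD.measurable_mask i)
  have hξm := hD.measurable_noise
  have ht2 : ∀ i, Integrable (fun ω => t i ω ^ 2) P := fun i => by
    refine hint.mono ((htm i).pow_const 2).aestronglyMeasurable (ae_of_all _ fun ω => ?_)
    rw [Real.norm_of_nonneg (sq_nonneg _),
      Real.norm_of_nonneg (Finset.sum_nonneg fun _ _ => sq_nonneg _)]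
    exact Finset.single_le_sum (f := fun i => t i ω ^ 2) (fun _ _ => sq_nonneg _)
      (Finset.mem_univ i)
  have htL : ∀ i, MemLp (t i) 2 P := fun i =>
    (memLp_two_iff_integrable_sq (htm i).aestronglyMeasurable).2 (ht2 i)
  have hξL : ∀ i, MemLp (ξ i) 2 P := fun i => by
    have h := memLp_id_gaussianReal (μ := 0) (v := (σ ^ 2).toNNReal) 2
    rw [← (hD.noise_law i).map_eq] at h
    exact h.comp_of_map (hξm i).aemeasurable
  have hξ1 : ∀ i, ∫ ω, ξ i ω ∂P = 0 := fun i => by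
    rw [(hD.noise_law i).integral_eq, integral_id_gaussianReal]
  have hξ2 : ∀ i, ∫ ω, ξ i ω ^ 2 ∂P = σ ^ 2 := fun i => by
    have h := (hD.noise_law i).variance_eq
    rw [variance_id_gaussianReal, variance_eq_sub (hξL i), hξ1,
      Real.coe_toNNReal _ (by positivity)] at h
    simpa using h
  have hξ2' : ∀ i j, ∫ ω, ξ i ω * ξ j ω ∂P = if i = j then σ ^ 2 else 0 := fun i j => by
    split_ifs with h
    · subst h; simpa [sq] using hξ2 i
    · have h' := (hD.noise_indep.indepFun h).integral_mul_eq_mul_integral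
        (hξm i).aestronglyMeasurable (hξm j).aestronglyMeasurable
      simpa [hξ1] using h'
  have hind : ∀ (f : (Fin N → Mat m T) → ℝ) (g : (Fin N → ℝ) → ℝ), Measurable f → Measurable g →
      IndepFun (fun ω => f fun i => X i ω) (fun ω => g fun i => ξ i ω) P := fun f g hf hg =>
    hD.mask_indep_noise.comp hf hg
  -- Expectations factor into a mask part and a noise part; the noise part vanishes off the
  -- diagonal.
  have hcross : ∀ i j, Integrable (fun ω => (t i ω * t j ω) * (ξ i ω * ξ j ω)) P ∧
      ∫ ω, (t i ω * t j ω) * (ξ i ω * ξ j ω) ∂P =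
        if i = j then (∫ ω, t i ω ^ 2 ∂P) * σ ^ 2 else 0 := fun i j => by
    have hI := hind (fun x => Matrix.trace ((x i).transpose * A) *
      Matrix.trace ((x j).transpose * A)) (fun z => z i * z j) (by fun_prop) (by fun_prop)
    refine ⟨hI.integrable_mul ((htL i).integrable_mul (htL j))
      ((hξL i).integrable_mul (hξL j)), ?_⟩
    have h' := hI.integral_mul_eq_mul_integral ((htm i).mul (htm j)).aestronglyMeasurable
      ((hξm i).mul (hξm j)).aestronglyMeasurable
    refine h'.trans ?_
    rw [hξ2']
    split_ifs with h
    · subst h; simp [sq, ht_def]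
    · simp
  have hlin : ∀ i, Integrable (fun ω => t i ω * ξ i ω) P ∧ ∫ ω, t i ω * ξ i ω ∂P = 0 := fun i => by
    have hI := hind (fun x => Matrix.trace ((x i).transpose * A)) (fun z => z i)
      (by fun_prop) (by fun_prop)
    refine ⟨(htL i).integrable_mul (hξL i), ?_⟩
    have h' := hI.integral_mul_eq_mul_integral (htm i).aestronglyMeasurable
      (hξm i).aestronglyMeasurable
    refine h'.trans ?_
    rw [hξ1, mul_zero]
  set U : Ω → ℝ := fun ω => ∑ i, t i ω * ξ i ω with hU
  have hUm : Measurable U := Finset.measurable_sum _ fun i _ => (htm i).mul (hξm i)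
  have hUsq : ∀ ω, U ω ^ 2 = ∑ i, ∑ j, (t i ω * t j ω) * (ξ i ω * ξ j ω) := fun ω => by
    rw [hU, sq, Finset.sum_mul_sum]
    exact Finset.sum_congr rfl fun i _ => Finset.sum_congr rfl fun j _ => by ring
  have hU2i : Integrable (fun ω => U ω ^ 2) P := by
    simp only [hUsq]
    exact integrable_finsetSum _ fun i _ => integrable_finsetSum _ fun j _ => (hcross i j).1
  have hU2 : ∫ ω, U ω ^ 2 ∂P = σ ^ 2 * ∫ ω, ∑ i, t i ω ^ 2 ∂P := by
    simp only [hUsq]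
    rw [integral_finsetSum _ fun i _ => integrable_finsetSum _ fun j _ => (hcross i j).1,
      integral_finsetSum _ fun i _ => ht2 i, Finset.mul_sum]
    refine Finset.sum_congr rfl fun i _ => ?_
    rw [integral_finsetSum _ fun j _ => (hcross i j).1]
    simp only [(hcross i _).2, Finset.sum_ite_eq, Finset.mem_univ, if_true]
    ring
  have hUL : MemLp U 2 P := (memLp_two_iff_integrable_sq hUm.aestronglyMeasurable).2 hU2i
  have hUi : Integrable U P := hUL.integrable one_le_two
  have hU1 : ∫ ω, U ω ∂P = 0 := by
    rw [hU, integral_finsetSum _ fun i _ => (hlin i).1]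
    exact Finset.sum_eq_zero fun i _ => (hlin i).2
  -- Jensen's inequality, as nonnegativity of the variance of `|U|`.
  have hUabs : (∫ ω, |U ω| ∂P) ^ 2 ≤ ∫ ω, U ω ^ 2 ∂P := by
    have h := variance_nonneg (fun ω => |U ω|) P
    rw [variance_eq_sub (X := fun ω => |U ω|) hUL.abs] at h
    simp only [Pi.pow_apply, sq_abs] at h
    linarith
  have hκ0 : 0 ≤ κ := by
    have : 0 ≤ ∫ ω, ∑ i, t i ω ^ 2 ∂P :=
      integral_nonneg fun ω => Finset.sum_nonneg fun _ _ => sq_nonneg _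
    have h2 : 0 ≤ 2 * σ ^ 2 * κ := this.trans hκ
    exact nonneg_of_mul_nonneg_right h2 (by positivity)
  have hUabs' : ∫ ω, |U ω| ∂P ≤ 2 * σ ^ 2 * √(κ / 2) := by
    refine le_of_sq_le_sq (hUabs.trans ?_) (by positivity)
    rw [hU2, mul_pow, Real.sq_sqrt (by positivity)]
    calc σ ^ 2 * ∫ ω, ∑ i, t i ω ^ 2 ∂P ≤ σ ^ 2 * (2 * σ ^ 2 * κ) := by gcongr
      _ = _ := by ring
  -- Under `P_A` the log-likelihood ratio is `(∑ t_i² / 2 + U) / σ²`. Markov's inequality needs a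
  -- nonnegative function, so `U` is replaced by its positive part `(U + |U|) / 2`; as `U` is
  -- centered, this costs only `E|U| / (2σ²) ≤ √(κ/2)`.
  let G : Ω → ℝ := fun ω => ((∑ i, t i ω ^ 2) / 2 + (U ω + |U ω|) / 2) / σ ^ 2
  have hGi : Integrable G P := ((hint.div_const 2).add ((hUi.add hUi.abs).div_const 2)).div_const _
  have hG : ∫ ω, G ω ∂P ≤ κ + √(κ / 2) := by
    have h1 : ∫ ω, G ω ∂P =
        ((∫ ω, ∑ i, t i ω ^ 2 ∂P) / 2 + (∫ ω, |U ω| ∂P) / 2) / σ ^ 2 := by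
      have h2 : ∫ ω, (U ω + |U ω|) ∂P = ∫ ω, |U ω| ∂P := by
        rw [integral_add hUi hUi.abs, hU1, zero_add]
      have h3 := integral_add (f := fun ω => (∑ i, t i ω ^ 2) / 2)
        (g := fun ω => (U ω + |U ω|) / 2) (hint.div_const 2) ((hUi.add hUi.abs).div_const 2)
      rw [integral_div, h3, integral_div, integral_div, h2]
    rw [h1, div_le_iff₀ (by positivity)]
    linarith
  have hGnn : ∀ ω, 0 ≤ G ω := fun ω => by
    have := neg_abs_le (U ω)
    have h2 : 0 ≤ U ω + |U ω| := by linarith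
    have h3 : 0 ≤ ∑ i, t i ω ^ 2 := Finset.sum_nonneg fun _ _ => sq_nonneg _
    positivity
  have hLG : ∀ ω, logLikelihoodRatio A σ (sample X ξ A ω) ≤ G ω := fun ω => by
    have : logLikelihoodRatio A σ (sample X ξ A ω) =
        ((∑ i, t i ω ^ 2) / 2 + U ω) / σ ^ 2 := by
      simp only [logLikelihoodRatio, sample, hU, ← Finset.sum_div]
      congr 1
      rw [Finset.sum_div, ← Finset.sum_add_distrib]
      exact Finset.sum_congr rfl fun i _ => by simp only [ht_def]; ring
    rw [this]
    refine div_le_div_of_nonneg_right ?_ (by positivity)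
    have := le_abs_self (U ω)
    linarith
  have hmarkov := mul_meas_ge_le_integral_of_nonneg (ae_of_all P hGnn) hGi c
  have hset : (sampleLaw P X ξ A).real {d | c < logLikelihoodRatio A σ d} ≤
      P.real {ω | c ≤ G ω} := by
    rw [sampleLaw, measureReal_def, Measure.map_apply (measurable_sample hD.measurable_mask hξm A)
      (measurableSet_lt measurable_const (measurable_logLikelihoodRatio A σ)), ← measureReal_def]
    exact measureReal_mono fun ω hω => (le_of_lt hω).trans (hLG ω)
  rw [le_div_iff₀ hc]
  nlinarith

end TraceRegression

/-! ### A lower bound for the error of multiple testing -/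

/-- If the hypotheses `Q i`, `i ∈ F`, and `Q₀` are tested by disjoint acceptance regions, each with
error probability at most `q`, and each likelihood ratio `dQ i / dQ₀` exceeds `exp c` with
`Q i`-probability at most `a`, then `q` cannot be small. -/
theorem MeasureTheory.card_mul_exp_neg_mul_le_of_disjoint_tests {𝒴 ι : Type*} [MeasurableSpace 𝒴]
    (Q : ι → Measure 𝒴) [∀ i, IsProbabilityMeasure (Q i)] (Q₀ : Measure 𝒴)
    [IsProbabilityMeasure Q₀] (F : Finset ι) {E : ι → Set 𝒴} {E₀ : Set 𝒴} {L : ι → 𝒴 → ℝ}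
    {a c q : ℝ} (hE : ∀ i, MeasurableSet (E i)) (hL : ∀ i, Measurable (L i))
    (hdisj : (F : Set ι).PairwiseDisjoint E) (hdisj₀ : ∀ i ∈ F, Disjoint (E i) E₀)
    (hchange : ∀ i ∈ F, ∀ S, MeasurableSet S → (∀ d ∈ S, L i d ≤ c) →
      Q i S ≤ ENNReal.ofReal (Real.exp c) * Q₀ S)
    (htail : ∀ i ∈ F, (Q i).real {d | c < L i d} ≤ a)
    (herr₀ : Q₀.real E₀ᶜ ≤ q) (herr : ∀ i ∈ F, (Q i).real (E i)ᶜ ≤ q) :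
    F.card * Real.exp (-c) * (1 - q - a) ≤ q := by
  -- The part of `E i` where `L i ≤ c` has `Q i`-mass at least `1 - q - a`, and there `Q i` is at
  -- most `exp c` times `Q₀`.
  have hone : ∀ i ∈ F, Real.exp (-c) * (1 - q - a) ≤ Q₀.real (E i) := fun i hi => by
    have hS : MeasurableSet (E i ∩ {d | L i d ≤ c}) :=
      (hE i).inter (measurableSet_le (hL i) measurable_const)
    have h1 : (Q i).real (E i ∩ {d | L i d ≤ c}) ≤ Real.exp c * Q₀.real (E i) := by
      have h := ENNReal.toReal_mono (by finiteness) (hchange i hi _ hS fun d hd => hd.2)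
      rw [ENNReal.toReal_mul, ENNReal.toReal_ofReal (Real.exp_pos c).le] at h
      exact h.trans (mul_le_mul_of_nonneg_left (measureReal_mono Set.inter_subset_left)
        (Real.exp_pos c).le)
    have h2 : 1 ≤ (Q i).real (E i ∩ {d | L i d ≤ c}) + (q + a) := by
      have h3 : (Q i).real (E i ∩ {d | L i d ≤ c})ᶜ ≤ q + a := by
        have hcompl : (E i ∩ {d | L i d ≤ c})ᶜ = (E i)ᶜ ∪ {d | c < L i d} := by
          ext d; simp [imp_iff_not_or]
        rw [hcompl]
        exact (measureReal_union_le _ _).trans (add_le_add (herr i hi) (htail i hi))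
      rw [probReal_compl_eq_one_sub hS] at h3
      linarith
    rw [Real.exp_neg, inv_mul_le_iff₀ (Real.exp_pos c)]
    linarith
  -- The regions are disjoint and lie in the rejection region of `Q₀`.
  have hsum : ∑ i ∈ F, Q₀.real (E i) ≤ q := by
    rw [← measureReal_biUnion_finset hdisj fun i _ => hE i]
    refine (measureReal_mono ?_).trans herr₀
    exact Set.iUnion₂_subset fun i hi => Set.subset_compl_iff_disjoint_right.2 (hdisj₀ i hi)
  refine le_trans ?_ hsum
  rw [mul_assoc, ← nsmul_eq_mul]
  exact Finset.card_nsmul_le_sum _ _ _ hone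

namespace TraceRegression

/-! ### The lower bound on the minimax probability -/

/-- The lower bound `√K / (1 + √K) * (1 - 2 α - √(2 α / log K))` with `K = 2 ^ (M / 8)`. -/
noncomputable def minimaxLowerBound (M : ℕ) (α : ℝ) : ℝ :=
  (2 : ℝ) ^ ((M : ℝ) / 16) / (1 + (2 : ℝ) ^ ((M : ℝ) / 16)) *
    (1 - 2 * α - √(16 * α / (M * Real.log 2)))

theorem minimaxLowerBound_pos {M : ℕ} {α : ℝ} (hM : 8 ≤ M) (hα : 0 < α) (hα' : α < 1 / 8) :
    0 < minimaxLowerBound M α := by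
  have hM' : (8 : ℝ) ≤ M := by exact_mod_cast hM
  have hlog := Real.log_two_gt_d9
  -- The radicand is below `2 / (8 log 2) < 25/64`, while `1 - 2α > 3/4`.
  have hsqrt : √(16 * α / (M * Real.log 2)) < 5 / 8 := by
    rw [Real.sqrt_lt' (by norm_num), div_lt_iff₀ (by positivity)]
    nlinarith
  have : 0 < 1 - 2 * α - √(16 * α / (M * Real.log 2)) := by linarith
  unfold minimaxLowerBound
  positivity

theorem tendsto_minimaxLowerBound :
    Tendsto (fun x : ℕ × ℝ => minimaxLowerBound x.1 x.2) (atTop ×ˢ 𝓝[>] (0 : ℝ)) (𝓝 1) := by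
  have hM : Tendsto (fun x : ℕ × ℝ => (x.1 : ℝ)) (atTop ×ˢ 𝓝[>] (0 : ℝ)) atTop :=
    tendsto_natCast_atTop_atTop.comp tendsto_fst
  have hα : Tendsto (fun x : ℕ × ℝ => x.2) (atTop ×ˢ 𝓝[>] (0 : ℝ)) (𝓝 0) :=
    (tendsto_nhdsWithin_of_tendsto_nhds tendsto_id).comp tendsto_snd |>.mono_right le_rfl
  have hx : Tendsto (fun x : ℕ × ℝ => (2 : ℝ) ^ ((x.1 : ℝ) / 16)) (atTop ×ˢ 𝓝[>] (0 : ℝ)) atTop :=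
    (tendsto_rpow_atTop_of_base_gt_one 2 (by norm_num)).comp (hM.atTop_div_const (by norm_num))
  have h1 : Tendsto (fun x : ℕ × ℝ => (2 : ℝ) ^ ((x.1 : ℝ) / 16) / (1 + (2 : ℝ) ^ ((x.1 : ℝ) / 16)))
      (atTop ×ˢ 𝓝[>] (0 : ℝ)) (𝓝 1) := by
    have h := (tendsto_atTop_add_const_left _ 1 hx).inv_tendsto_atTop.const_sub 1
    rw [sub_zero] at h
    refine h.congr fun x => ?_
    have : 0 < 1 + (2 : ℝ) ^ ((x.1 : ℝ) / 16) := by positivity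
    simp only [Pi.inv_apply]
    field_simp
    ring
  have h2 : Tendsto (fun x : ℕ × ℝ => √(16 * x.2 / (x.1 * Real.log 2)))
      (atTop ×ˢ 𝓝[>] (0 : ℝ)) (𝓝 0) := by
    have h := ((hα.const_mul 16).mul
      (hM.atTop_mul_const (Real.log_pos one_lt_two)).inv_tendsto_atTop).sqrt
    simpa [div_eq_mul_inv] using h
  have h3 := h1.mul (((hα.const_mul 2).const_sub 1).sub h2)
  simpa [minimaxLowerBound] using h3

/-- The choice of the rank `s` and of the level `h` in the construction of the hypotheses. -/
theorem exists_rank_level {M N r : ℕ} {p Δ α σ ν : ℝ} (hM : 0 < M) (hN : 0 < N) (hr : 1 ≤ r)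
    (hp : 0 < p) (hp2 : p ≤ 2) (hΔ : 0 < Δ) (hα : 0 < α) (hα' : α < 1 / 8) (hσ : 0 < σ)
    (hν : 0 < ν) :
    ∃ (s : ℕ) (h : ℝ), 1 ≤ s ∧ s ≤ r ∧
      4 * N * h ^ 2 ≤ α * Real.log 2 * (σ ^ 2 * ν ^ 2) ∧
      (s : ℝ) ^ (2 / p) * (s * M * h ^ 2) ≤ s * (Δ * ν * σ) ^ 2 ∧
      4 * (ν ^ 2 * (lowerConst p α * σ ^ 2 * rate p M N r Δ)) < s * M / 8 * h ^ 2 := by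
  have hM' : (0 : ℝ) < M := by exact_mod_cast hM
  have hN' : (0 : ℝ) < N := by exact_mod_cast hN
  have hr' : (1 : ℝ) ≤ r := by exact_mod_cast hr
  have hlog : 0 < Real.log 2 := Real.log_pos one_lt_two
  have hlog1 := Real.log_two_lt_d9
  set a : ℝ := α * Real.log 2 with ha
  have ha0 : 0 < a := by positivity
  have ha1 : a ≤ 1 := by nlinarith
  set g : ℝ := (2 : ℝ) ^ (-2 / p) with hg
  have hg0 : 0 < g := by positivity
  have hg1 : g ≤ 1 / 2 := by
    calc g ≤ (2 : ℝ) ^ (-1 : ℝ) := by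
          refine Real.rpow_le_rpow_of_exponent_le one_le_two ?_
          rw [div_le_iff₀ hp]; linarith
      _ = 1 / 2 := by rw [Real.rpow_neg_one]; norm_num
  set ψ := rate p M N r Δ with hψ
  have hψ1 : ψ ≤ r * M / N := min_le_left _ _
  have hψ2 : ψ ≤ Δ ^ p * ((M : ℝ) / N) ^ (1 - p / 2) := (min_le_right _ _).trans (min_le_left _ _)
  have hψ3 : ψ ≤ Δ ^ 2 := (min_le_right _ _).trans (min_le_right _ _)
  have hconst : 4 * (ν ^ 2 * (lowerConst p α * σ ^ 2 * ψ)) = a / 32 * (σ ^ 2 * ν ^ 2) * (g * ψ) := by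
    rw [lowerConst, ← ha, ← hg]; ring
  rw [hconst]
  -- If `q < 1`, the Schatten ball is the binding constraint even at rank one: `h` scales with `Δ`
  -- and the term `Δ²` of the rate is used. Otherwise `h` is the largest level allowed by the
  -- divergence, and the ball admits ranks up to `Q = q^(p/2)`; `Q M / N` is the middle term of the
  -- rate.
  set q : ℝ := Δ ^ 2 * N / M with hq
  have hq0 : 0 < q := by positivity
  rcases lt_or_ge q 1 with hq1 | hq1
  · refine ⟨1, √(a / 4 / M) * (Δ * σ * ν), le_rfl, hr, ?_, ?_, ?_⟩
    all_goals rw [mul_pow, Real.sq_sqrt (by positivity)]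
    · calc 4 * N * (a / 4 / M * (Δ * σ * ν) ^ 2) = a * (σ ^ 2 * ν ^ 2) * q := by
            rw [hq]; field_simp
        _ ≤ a * (σ ^ 2 * ν ^ 2) := mul_le_of_le_one_right (by positivity) hq1.le
    · rw [Nat.cast_one, Real.one_rpow, one_mul, one_mul, one_mul]
      calc M * (a / 4 / M * (Δ * σ * ν) ^ 2) = a / 4 * (Δ * ν * σ) ^ 2 := by field_simp
        _ ≤ (Δ * ν * σ) ^ 2 := mul_le_of_le_one_left (by positivity) (by linarith)
    · have hlt : g * ψ < Δ ^ 2 := by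
        have : g * ψ ≤ g * Δ ^ 2 := by gcongr
        have hΔ2 : 0 < Δ ^ 2 := by positivity
        nlinarith
      calc a / 32 * (σ ^ 2 * ν ^ 2) * (g * ψ) < a / 32 * (σ ^ 2 * ν ^ 2) * Δ ^ 2 := by gcongr
        _ = _ := by push_cast; field_simp; norm_num
  · set Q : ℝ := q ^ (p / 2) with hQ
    have hQ1 : 1 ≤ Q := Real.one_le_rpow hq1 (by positivity)
    have hQψ : ψ ≤ Q * (M / N) := by
      refine hψ2.trans_eq ?_
      have h1 : q = Δ ^ 2 * ((M : ℝ) / N)⁻¹ := by rw [hq]; field_simp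
      have h2 : (Δ ^ 2) ^ (p / 2) = Δ ^ p := by
        rw [← Real.rpow_natCast, ← Real.rpow_mul hΔ.le]; congr 1; push_cast; ring
      rw [hQ, h1, Real.mul_rpow (by positivity) (by positivity), h2, sub_eq_add_neg,
        Real.rpow_add (by positivity), Real.rpow_one, Real.inv_rpow (by positivity),
        Real.rpow_neg (by positivity)]
      ring
    -- Rounding loses less than a factor 2, which `g ≤ 1/2` absorbs.
    have hfl : Q < 2 * ⌊Q⌋₊ := by
      have h1 := Nat.lt_floor_add_one Q
      have h2 : (1 : ℝ) ≤ ⌊Q⌋₊ := by exact_mod_cast (Nat.one_le_floor_iff Q).2 hQ1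
      linarith
    set s := min r ⌊Q⌋₊ with hs
    have hs1 : 1 ≤ s := le_min hr ((Nat.one_le_floor_iff Q).2 hQ1)
    have hsQ : (s : ℝ) ≤ Q :=
      le_trans (by exact_mod_cast min_le_right _ _) (Nat.floor_le (by positivity))
    have hs0 : (0 : ℝ) < s := by exact_mod_cast hs1
    refine ⟨s, √(a / 4 / N) * (σ * ν), hs1, min_le_left _ _, ?_, ?_, ?_⟩
    all_goals rw [mul_pow, Real.sq_sqrt (by positivity)]
    · refine le_of_eq ?_
      field_simp
    · have h1 : (s : ℝ) ^ (2 / p) ≤ q := by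
        calc (s : ℝ) ^ (2 / p) ≤ Q ^ (2 / p) := by gcongr
          _ = q := by
            rw [hQ, ← Real.rpow_mul hq0.le, show p / 2 * (2 / p) = 1 by field_simp, Real.rpow_one]
      calc (s : ℝ) ^ (2 / p) * (s * M * (a / 4 / N * (σ * ν) ^ 2))
          ≤ q * (s * M * (a / 4 / N * (σ * ν) ^ 2)) := by gcongr
        _ = a / 4 * (s * (Δ * ν * σ) ^ 2) := by rw [hq]; field_simp
        _ ≤ s * (Δ * ν * σ) ^ 2 := mul_le_of_le_one_left (by positivity) (by linarith)
    · have hlt : g * ψ < s * (M / N) := by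
        have hMN : (0 : ℝ) < M / N := by positivity
        rcases min_choice r ⌊Q⌋₊ with h | h
        · rw [hs, h]
          rw [mul_div_assoc] at hψ1
          have h2 : g * ψ ≤ g * (r * (M / N)) := by gcongr
          have h3 : 0 < r * ((M : ℝ) / N) := by positivity
          nlinarith
        · rw [hs, h]
          calc g * ψ ≤ g * (Q * (M / N)) := by gcongr
            _ ≤ 1 / 2 * (Q * (M / N)) := by gcongr
            _ < ⌊Q⌋₊ * (M / N) := by nlinarith
      calc a / 32 * (σ ^ 2 * ν ^ 2) * (g * ψ) < a / 32 * (σ ^ 2 * ν ^ 2) * (s * (M / N)) := by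
            gcongr
        _ = _ := by field_simp; norm_num

theorem norm_samplingOperator_sq {N m T : ℕ} (X : Fin N → Mat m T) (A : Mat m T) :
    ‖samplingOperator X A‖ ^ 2 = (∑ i, Matrix.trace ((X i).transpose * A) ^ 2) / N := by
  rw [EuclideanSpace.real_norm_sq_eq, Finset.sum_div]
  refine Finset.sum_congr rfl fun i _ => ?_
  simp [samplingOperator, div_pow]

/-- Under the sampling bound, the squared signal of a matrix of small rank is controlled by its
Frobenius norm. -/
theorem SamplingBound.integral_sum_sq_le {Ω : Type*} [MeasurableSpace Ω] {P : Measure Ω}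
    {N m T r : ℕ} {X : Fin N → Ω → Mat m T} {ν : ℝ} (hX : SamplingBound P X r ν) (hN : 0 < N)
    {A : Mat m T} (hA : A.rank ≤ r) :
    Integrable (fun ω => ∑ i, Matrix.trace ((X i ω).transpose * A) ^ 2) P ∧
      ν ^ 2 * ∫ ω, ∑ i, Matrix.trace ((X i ω).transpose * A) ^ 2 ∂P ≤
        N * ∑ k, ∑ l, A k l ^ 2 := by
  have hN' : (0 : ℝ) < N := by exact_mod_cast hN
  obtain ⟨h1, h2⟩ := hX A hA
  simp only [norm_samplingOperator_sq] at h1 h2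
  rw [integral_div, schattenNorm_two_sq, ← mul_div_assoc, div_le_iff₀ hN'] at h2
  refine ⟨?_, by linarith⟩
  have h := h1.mul_const (N : ℝ)
  simpa only [div_mul_cancel₀ _ hN'.ne'] using h

theorem IsGaussianDesign.isProbabilityMeasure_sampleLaw {Ω : Type*} [MeasurableSpace Ω]
    {P : Measure Ω} [IsProbabilityMeasure P] {N m T : ℕ} {X : Fin N → Ω → Mat m T}
    {ξ : Fin N → Ω → ℝ} {σ : ℝ} (hD : IsGaussianDesign P X ξ σ) (A : Mat m T) :
    IsProbabilityMeasure (sampleLaw P X ξ A) :=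
  Measure.isProbabilityMeasure_map
    (measurable_sample hD.measurable_mask hD.measurable_noise A).aemeasurable

theorem measurableSet_estimation_error_le {N m T : ℕ} {Ahat : Sample N m T → Mat m T}
    (hAhat : Measurable Ahat) (A : Mat m T) (ν t : ℝ) :
    MeasurableSet {d | 1 / ν ^ 2 * schattenNorm 2 (Ahat d - A) ^ 2 ≤ t} := by
  simp only [schattenNorm_two_sq, Matrix.sub_apply]
  refine measurableSet_le ?_ measurable_const
  have : ∀ k l, Measurable fun d => Ahat d k l := fun k l =>
    (measurable_pi_apply l).comp ((measurable_pi_apply k).comp hAhat)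
  fun_prop

/-- By `‖A - B‖² ≤ 2‖Â - A‖² + 2‖Â - B‖²`, two errors of at most `ν² t` force `‖A - B‖² ≤ 4ν² t`. -/
theorem disjoint_estimation_error_le {N m T : ℕ} {Ahat : Sample N m T → Mat m T} {A B : Mat m T}
    {ν t : ℝ} (hν : 0 < ν) (hAB : 4 * (ν ^ 2 * t) < ∑ k, ∑ l, (A k l - B k l) ^ 2) :
    Disjoint {d | 1 / ν ^ 2 * schattenNorm 2 (Ahat d - A) ^ 2 ≤ t}
      {d | 1 / ν ^ 2 * schattenNorm 2 (Ahat d - B) ^ 2 ≤ t} := by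
  refine Set.disjoint_left.2 fun d hA hB => hAB.not_ge ?_
  have hν2 : 0 < ν ^ 2 := by positivity
  simp only [Set.mem_ofPred_eq, schattenNorm_two_sq, Matrix.sub_apply, one_div,
    inv_mul_le_iff₀ hν2] at hA hB
  have h : ∑ k, ∑ l, (A k l - B k l) ^ 2 ≤
      2 * ∑ k, ∑ l, (Ahat d k l - A k l) ^ 2 + 2 * ∑ k, ∑ l, (Ahat d k l - B k l) ^ 2 := by
    simp only [Finset.mul_sum, ← Finset.sum_add_distrib]
    refine Finset.sum_le_sum fun k _ => Finset.sum_le_sum fun l _ => ?_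
    nlinarith [sq_nonneg ((Ahat d k l - A k l) + (Ahat d k l - B k l))]
  linarith

/-- The general lower bound. -/
theorem minimaxLowerBound_le_minimaxProb {Ω : Type*} [MeasurableSpace Ω] {P : Measure Ω}
    [IsProbabilityMeasure P] {N m T r : ℕ} {X : Fin N → Ω → Mat m T} {ξ : Fin N → Ω → ℝ}
    {σ ν : ℝ} (hN : 0 < N) (hσ : 0 < σ) (hν : 0 < ν) (hM : 8 ≤ max m T) (hr : 1 ≤ r)
    (hrmT : r ≤ min T m) (hD : IsGaussianDesign P X ξ σ) (hX : SamplingBound P X r ν)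
    {p Δ α : ℝ} (hp : 0 < p) (hp2 : p ≤ 2) (hΔ : 0 < Δ) (hα : 0 < α) (hα' : α < 1 / 8) :
    ENNReal.ofReal (minimaxLowerBound (max m T) α) ≤
      minimaxProb P X ξ (parameterSet m T r p (Δ * ν * σ)) ν
        (lowerConst p α * σ ^ 2 * rate p (max m T) N r Δ) := by
  classical
  set M := max m T with hMdef
  obtain ⟨s, h, hs1, hsr, hKL, hSp, hsep⟩ :=
    exists_rank_level (M := M) (N := N) (r := r) (by omega) hN hr hp hp2 hΔ hα hα' hσ hν
  set t := lowerConst p α * σ ^ 2 * rate p M N r Δ with ht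
  obtain ⟨S, hScard, hSrank⟩ := exists_block (m := m) (T := T) (s := s) (hsr.trans hrmT)
  rw [← hMdef] at hScard
  have hMd : M ≤ S.card := by rw [hScard]; exact Nat.le_mul_of_pos_left _ hs1
  obtain ⟨F, hF0, hFS, hFd, hFcard⟩ := S.exists_varshamov_gilbert (hM.trans hMd)
  have hdcast : (S.card : ℝ) = s * M := by rw [hScard]; push_cast; ring
  set d : ℝ := (S.card : ℝ) with hd
  have hM8 : (8 : ℝ) ≤ M := by exact_mod_cast hM
  have hMd' : (M : ℝ) ≤ d := by rw [hd]; exact_mod_cast hMd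
  have hlog : 0 < Real.log 2 := Real.log_pos one_lt_two
  have hcard_le : ∀ B ∈ F, (B.card : ℝ) ≤ d := fun B hB => by
    rw [hd]; exact_mod_cast Finset.card_le_card (hFS B hB)
  have hmem : ∀ B ∈ F, levelMatrix h B ∈ parameterSet m T r p (Δ * ν * σ) := fun B hB => by
    refine ⟨(hSrank h B (hFS B hB)).trans hsr,
      schattenNorm_le_of_rank_le (hSrank h B (hFS B hB)) hp hp2 (by positivity) ?_⟩
    refine le_trans ?_ hSp
    rw [sum_levelMatrix_sq, ← hdcast]
    have := hcard_le B hB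
    gcongr
  refine le_iInf₂ fun Ahat hAhat => ?_
  -- The assumed strict bound makes the supremum finite, so its real value `q` dominates every error
  -- probability.
  by_contra! hlt
  set q := (⨆ A ∈ parameterSet m T r p (Δ * ν * σ),
    sampleLaw P X ξ A {x | t < 1 / ν ^ 2 * schattenNorm 2 (Ahat x - A) ^ 2}).toReal with hq
  have hqlt : q < minimaxLowerBound M α := ENNReal.toReal_lt_of_lt_ofReal hlt
  have hq0 : 0 ≤ q := ENNReal.toReal_nonneg
  have herr : ∀ B ∈ F, (sampleLaw P X ξ (levelMatrix h B)).real
      {x | 1 / ν ^ 2 * schattenNorm 2 (Ahat x - levelMatrix h B) ^ 2 ≤ t}ᶜ ≤ q := fun B hB => by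
    have hcompl : {x | 1 / ν ^ 2 * schattenNorm 2 (Ahat x - levelMatrix h B) ^ 2 ≤ t}ᶜ =
        {x | t < 1 / ν ^ 2 * schattenNorm 2 (Ahat x - levelMatrix h B) ^ 2} := by
      ext x; simp
    rw [hcompl]
    exact ENNReal.toReal_mono hlt.ne_top (le_iSup₂ (f := fun A _ => sampleLaw P X ξ A
      {x | t < 1 / ν ^ 2 * schattenNorm 2 (Ahat x - A) ^ 2}) _ (hmem B hB))
  have hdisj : ∀ B ∈ F, ∀ C ∈ F, B ≠ C →
      Disjoint {x | 1 / ν ^ 2 * schattenNorm 2 (Ahat x - levelMatrix h B) ^ 2 ≤ t}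
        {x | 1 / ν ^ 2 * schattenNorm 2 (Ahat x - levelMatrix h C) ^ 2 ≤ t} :=
    fun B hB C hC hBC => by
      refine disjoint_estimation_error_le hν ?_
      rw [sum_levelMatrix_sub_sq]
      refine hsep.trans_le ?_
      rw [← hdcast]
      have := hFd B hB C hC hBC
      gcongr
  have hprob := fun A => hD.isProbabilityMeasure_sampleLaw A
  -- With `K = 2^(d/8)`, `κ = α log K` bounds the divergences and the threshold is `c = (log K) /
  -- 2`, so that `K exp(-c) = √K`.
  set κ : ℝ := α * Real.log 2 * d / 8 with hκ
  set c : ℝ := d / 16 * Real.log 2 with hc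
  have hd0 : 0 < d := by linarith
  have hc0 : 0 < c := by positivity
  have hF := card_mul_exp_neg_mul_le_of_disjoint_tests
    (fun B : Finset (Fin m × Fin T) => sampleLaw P X ξ (levelMatrix h B)) (sampleLaw P X ξ 0)
    (F.erase ∅) (E := fun B => {x | 1 / ν ^ 2 * schattenNorm 2 (Ahat x - levelMatrix h B) ^ 2 ≤ t})
    (E₀ := {x | 1 / ν ^ 2 * schattenNorm 2 (Ahat x - levelMatrix h ∅) ^ 2 ≤ t})
    (L := fun B => logLikelihoodRatio (levelMatrix h B) σ) (a := (κ + √(κ / 2)) / c) (c := c)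
    (q := q) (fun B => measurableSet_estimation_error_le hAhat _ ν t)
    (fun B => measurable_logLikelihoodRatio _ σ)
    (fun B hB C hC hBC => hdisj B (Finset.mem_of_mem_erase hB) C (Finset.mem_of_mem_erase hC) hBC)
    (fun B hB => hdisj B (Finset.mem_of_mem_erase hB) ∅ hF0 (Finset.ne_of_mem_erase hB))
    (fun B hB S hS hc => hD.sampleLaw_le_of_logLikelihoodRatio_le hσ _ hS hc)
    (fun B hB => by
      have hB' := Finset.mem_of_mem_erase hB
      obtain ⟨h1, h2⟩ := hX.integral_sum_sq_le hN ((hSrank h B (hFS B hB')).trans hsr)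
      refine hD.sampleLaw_lt_logLikelihoodRatio_le hσ _ h1 ?_ hc0
      rw [sum_levelMatrix_sq] at h2
      have hν2 : 0 < ν ^ 2 := by positivity
      refine le_of_mul_le_mul_left (h2.trans ?_) hν2
      calc (N : ℝ) * (B.card * h ^ 2) ≤ N * (d * h ^ 2) := by
            have := hcard_le B hB'
            gcongr
        _ = d / 4 * (4 * N * h ^ 2) := by ring
        _ ≤ d / 4 * (α * Real.log 2 * (σ ^ 2 * ν ^ 2)) := by gcongr
        _ = _ := by rw [hκ]; ring)
    (by simpa only [levelMatrix_empty] using herr ∅ hF0)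
    (fun B hB => herr B (Finset.mem_of_mem_erase hB))
  set x : ℝ := (2 : ℝ) ^ ((M : ℝ) / 16) with hx
  have hx0 : 0 < x := by positivity
  have hK : x ≤ (F.erase ∅).card * Real.exp (-c) := by
    have hexp : Real.exp (-c) = (2 : ℝ) ^ (-(d / 16)) := by
      rw [Real.rpow_def_of_pos two_pos, hc]; congr 1; ring
    rw [hexp]
    calc x ≤ (2 : ℝ) ^ (d / 16) := Real.rpow_le_rpow_of_exponent_le one_le_two (by linarith)
      _ = (2 : ℝ) ^ (d / 8) * (2 : ℝ) ^ (-(d / 16)) := by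
        rw [← Real.rpow_add two_pos]; congr 1; ring
      _ ≤ _ := by gcongr
  -- The bound equals `2α + √(16α / (d log 2))`, and `M ≤ d` makes it uniform in `s`.
  have ha : (κ + √(κ / 2)) / c ≤ 2 * α + √(16 * α / (M * Real.log 2)) := by
    have h1 : √(κ / 2) = √(16 * α / (d * Real.log 2)) * c := by
      rw [← Real.sqrt_sq hc0.le, ← Real.sqrt_mul (by positivity)]
      congr 1
      rw [hκ, hc]; field_simp; norm_num
    have h2 : κ = 2 * α * c := by rw [hκ, hc]; ring
    rw [h1, h2, ← add_mul, mul_div_cancel_right₀ _ hc0.ne']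
    gcongr
  refine hqlt.not_ge ?_
  set b := 1 - 2 * α - √(16 * α / (M * Real.log 2)) with hb
  -- Solved for `q`, this is `q ≥ x b / (1 + x)`. The sign of `b - q` matters because `hK` only
  -- bounds the other factor from below.
  have hxb : x * (b - q) ≤ q := by
    rcases le_or_gt (b - q) 0 with h0 | h0
    · exact (mul_nonpos_of_nonneg_of_nonpos hx0.le h0).trans hq0
    · refine le_trans ?_ hF
      have h1 : b - q ≤ 1 - q - (κ + √(κ / 2)) / c := by rw [hb]; linarith
      exact mul_le_mul hK h1 h0.le (hx0.le.trans hK)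
  rw [minimaxLowerBound, ← hx, ← hb, div_mul_eq_mul_div, div_le_iff₀ (by positivity)]
  linarith

/-! ### Uniform sampling at random -/

instance instMeasurableSingletonClassMat (m T : ℕ) : MeasurableSingletonClass (Mat m T) :=
  inferInstanceAs (MeasurableSingletonClass (Fin m → Fin T → ℝ))

theorem single_one_injective (m T : ℕ) :
    Function.Injective fun x : Fin m × Fin T => (Matrix.single x.1 x.2 1 : Mat m T) := by
  rintro ⟨k, l⟩ ⟨k', l'⟩ h
  have h1 := congrFun (congrFun h k) l
  simp only [Matrix.single_apply, and_self, if_true] at h1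
  by_contra hne
  rw [if_neg fun h2 => hne (Prod.ext h2.1.symm h2.2.symm)] at h1
  exact one_ne_zero h1

theorem integral_uniformOn_pointMasks {m T : ℕ} (hm : 0 < m) (hT : 0 < T) (f : Mat m T → ℝ) :
    Integrable f (uniformOn (pointMasks m T)) ∧
      (m : ℝ) * T * ∫ x, f x ∂uniformOn (pointMasks m T) =
        ∑ k, ∑ l, f (Matrix.single k l 1) := by
  classical
  set s : Finset (Mat m T) := Finset.univ.map ⟨_, single_one_injective m T⟩ with hs
  have hset : pointMasks m T = s := by
    ext B
    simp [pointMasks, hs, eq_comm]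
  have hcard : s.card = m * T := by simp [hs]
  have hunif : uniformOn (pointMasks m T) =
      ((m * T : ℕ) : ℝ≥0∞)⁻¹ • Measure.count.restrict (s : Set (Mat m T)) := by
    rw [uniformOn, ProbabilityTheory.cond, hset, Measure.count_apply_finset, hcard]
  have hint : IntegrableOn f (s : Set (Mat m T)) Measure.count := by
    rw [← Finset.biUnion_singleton_eq_self (s := s), Finset.coe_biUnion]
    refine (integrableOn_finset_iUnion (s := s)).2 fun x _ => ?_
    rw [Finset.coe_singleton]
    exact integrableOn_singleton (by simp) (by simp)
  have hmT : (m : ℝ) * T ≠ 0 := by positivity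
  rw [hunif]
  refine ⟨hint.smul_measure (by simp [hm.ne', hT.ne']), ?_⟩
  rw [integral_smul_measure, setIntegral_finset _ hint, hs, Finset.sum_map]
  simp only [Measure.real, Measure.count_singleton, ENNReal.toReal_inv, ENNReal.toReal_natCast,
    smul_eq_mul, ENNReal.toReal_one, one_mul, Function.Embedding.coeFn_mk]
  rw [Fintype.sum_prod_type, Nat.cast_mul, mul_inv_cancel_left₀ hmT]

/-- A point mask reads off one entry of `A`, so the mean square of each observation without noise is
`‖A‖_{S_2}² / (mT)`. -/
theorem IsUSR.integral_norm_samplingOperator_sq {Ω : Type*} [MeasurableSpace Ω] {P : Measure Ω}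
    {N m T : ℕ} {X : Fin N → Ω → Mat m T} (hX : IsUSR P X) (hN : 0 < N) (hm : 0 < m) (hT : 0 < T)
    (A : Mat m T) :
    Integrable (fun ω => ‖samplingOperator (fun i => X i ω) A‖ ^ 2) P ∧
      ((m : ℝ) * T) * ∫ ω, ‖samplingOperator (fun i => X i ω) A‖ ^ 2 ∂P =
        schattenNorm 2 A ^ 2 := by
  have hN' : (N : ℝ) ≠ 0 := by exact_mod_cast hN.ne'
  let f : Mat m T → ℝ := fun x => Matrix.trace (x.transpose * A) ^ 2
  have hf : Measurable f := (measurable_trace_transpose_mul A measurable_id).pow_const 2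
  obtain ⟨h1, h2⟩ := integral_uniformOn_pointMasks hm hT f
  have hsingle : ∀ k l, f (Matrix.single k l 1) = A k l ^ 2 := fun k l => by
    simp [f, trace_transpose_mul_eq, Matrix.single_apply, ite_and]
  simp only [hsingle] at h2
  have hi : ∀ i, Integrable (fun ω => f (X i ω)) P ∧
      (m : ℝ) * T * ∫ ω, f (X i ω) ∂P = ∑ k, ∑ l, A k l ^ 2 := fun i => by
    have hlaw := hX.law i
    refine ⟨?_, ?_⟩
    · rw [← hlaw.map_eq] at h1
      exact h1.comp_aemeasurable hlaw.aemeasurable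
    · rw [← h2, ← hlaw.integral_comp hf.aestronglyMeasurable]
      rfl
  simp only [norm_samplingOperator_sq, schattenNorm_two_sq]
  refine ⟨(integrable_finsetSum _ fun i _ => (hi i).1).div_const _, ?_⟩
  rw [integral_div, integral_finsetSum _ fun i _ => (hi i).1, ← mul_div_assoc, Finset.mul_sum]
  rw [Finset.sum_congr rfl fun i _ => (hi i).2]
  simp [hN']

end TraceRegression


theorem theorem6 :
    ∃ β : ℕ → ℝ → ℝ,
      (∀ (M : ℕ) (α : ℝ), 8 ≤ M → 0 < α → α < 1 / 8 → 0 < β M α) ∧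
      Tendsto (fun x : ℕ × ℝ => β x.1 x.2) (atTop ×ˢ 𝓝[>] (0 : ℝ)) (𝓝 1) ∧
      -- the general lower bound
      (∀ (Ω : Type*) [MeasurableSpace Ω] (P : Measure Ω) [IsProbabilityMeasure P]
        (N m T r : ℕ) (X : Fin N → Ω → TraceRegression.Mat m T) (ξ : Fin N → Ω → ℝ)
        (σ ν : ℝ),
        0 < N → 0 < σ → 0 < ν → 8 ≤ max m T → 1 ≤ r → r ≤ min T m →
        TraceRegression.IsGaussianDesign P X ξ σ →
        TraceRegression.SamplingBound P X r ν →
        ∀ p Δ α : ℝ, 0 < p → p ≤ 2 → 0 < Δ → 0 < α → α < 1 / 8 →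
          ENNReal.ofReal (β (max m T) α) ≤
            TraceRegression.minimaxProb P X ξ
              (TraceRegression.parameterSet m T r p (Δ * ν * σ)) ν
              (TraceRegression.lowerConst p α * σ ^ 2 *
                TraceRegression.rate p (max m T) N r Δ)) ∧
      -- uniform sampling at random, with `ν = √(mT)`
      (∀ (Ω : Type*) [MeasurableSpace Ω] (P : Measure Ω) [IsProbabilityMeasure P]
        (N m T r : ℕ) (X : Fin N → Ω → TraceRegression.Mat m T) (ξ : Fin N → Ω → ℝ)
        (σ : ℝ),
        0 < N → 0 < σ → 8 ≤ max m T → 1 ≤ r → r ≤ min T m →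
        TraceRegression.IsGaussianDesign P X ξ σ →
        TraceRegression.IsUSR P X →
        (∀ A : TraceRegression.Mat m T,
          Integrable
            (fun ω => ‖TraceRegression.samplingOperator (fun i => X i ω) A‖ ^ 2) P ∧
          ((m : ℝ) * T) *
              ∫ ω, ‖TraceRegression.samplingOperator (fun i => X i ω) A‖ ^ 2 ∂P =
            TraceRegression.schattenNorm 2 A ^ 2) ∧
        ∀ p Δ α : ℝ, 0 < p → p ≤ 2 → 0 < Δ → 0 < α → α < 1 / 8 →
          ENNReal.ofReal (β (max m T) α) ≤
            TraceRegression.minimaxProb P X ξ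
              (TraceRegression.parameterSet m T r p (Δ * √((m : ℝ) * T) * σ))
              (√((m : ℝ) * T))
              (TraceRegression.lowerConst p α * σ ^ 2 *
                TraceRegression.rate p (max m T) N r Δ)) := by
  refine ⟨TraceRegression.minimaxLowerBound,
    fun M α hM hα hα' => TraceRegression.minimaxLowerBound_pos hM hα hα',
    TraceRegression.tendsto_minimaxLowerBound, ?_, ?_⟩
  · intro Ω _ P _ N m T r X ξ σ ν hN hσ hν hM hr hrmT hD hX p Δ α hp hp2 hΔ hα hα'
    exact TraceRegression.minimaxLowerBound_le_minimaxProb hN hσ hν hM hr hrmT hD hX hp hp2 hΔ hα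
      hα'
  · intro Ω _ P _ N m T r X ξ σ hN hσ hM hr hrmT hD hX
    have hm : 0 < m := hr.trans (hrmT.trans (min_le_right _ _))
    have hT : 0 < T := hr.trans (hrmT.trans (min_le_left _ _))
    have hE := hX.integral_norm_samplingOperator_sq hN hm hT
    refine ⟨hE, fun p Δ α hp hp2 hΔ hα hα' => ?_⟩
    refine TraceRegression.minimaxLowerBound_le_minimaxProb hN hσ (by positivity) hM hr hrmT hD
      (fun A _ => ⟨(hE A).1, ?_⟩) hp hp2 hΔ hα hα'
    rw [Real.sq_sqrt (by positivity)]
    exact (hE A).2.le
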